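/- Let $E$ be a finite-dimensional real Banach space and let $C\subseteq E$ be an open (convex) cone whose closure $\overline C$ is proper, i.e. $\overline C\cap(-\overline C)=\{0\}$. Order $C$ by $x\le y$ iff $y-x\in\overline C$, and equip $C$ with the Thompson metric $d_T(x,y)=\max\{\log M(x/y),\log M(y/x)\}$, where $M(x/y)=\inf\{\lambda>0: x\le\lambda y\}$ (if $E=\{0\}$, $C$ is a single point and $d_T=0$). Let $\mathcal P(C)$ be the set of Borel probability measures on $C$. For $\mu,\nu\in\mathcal P(C)$ write $\mu\le\nu$ if $\mu(U)\le\nu(U)$ for every open upper set $U\subseteq C$, where $U$ is an upper set if $x\in U$, $x\le y\in C$ imply $y\in U$. Let $\mu_n,\nu\in\mathcal P(C)$ for $n\in\mathbb N$. (1) If $\mu_1\le\mu_2\le\cdots\le\nu$ (that is, $\mu_n\le\mu_{n+1}$ and $\mu_n\le\nu$ for all $n$), then there exists $\mu\in\mathcal P(C)$ such that $\mu_n\le\mu\le\nu$ for all $n$ and $\mu_n\to\mu$ weakly. (2) If $\mu_1\ge\mu_2\ge\cdots\ge\nu$ (that is, $\mu_n\ge\mu_{n+1}$ and $\mu_n\ge\nu$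 for all $n$), then there exists $\mu\in\mathcal P(C)$ such that $\mu_n\ge\mu\ge\nu$ for all $n$ and $\mu_n\to\mu$ weakly. Here $\mu_n\to\mu$ weakly means $\int_C f\,d\mu_n\to\int_C f\,d\mu$ for every bounded continuous $f:C\to\mathbb R$. -/

import Mathlib

open Filter Topology MeasureTheory
open scoped Pointwise

/-- The stochastic order between Borel probability measures on a topological space with an
order relation: `μ ≤ ν` iff `μ U ≤ ν U` for every open upper set `U`. -/
def StochLE {X : Type*} [TopologicalSpace X] [MeasurableSpace X] [LE X]
    (μ ν : ProbabilityMeasure X) : Prop :=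
  ∀ U : Set X, IsOpen U → IsUpperSet U → (μ : Measure X) U ≤ (ν : Measure X) U

section Cone

variable {E : Type*} [NormedAddCommGroup E] [NormedSpace ℝ E]

/-- `C` is an open (convex) cone whose closure is a proper cone, that is
`closure C ∩ -closure C = {0}`. In particular `C` is nonempty. -/
structure IsOpenProperCone (C : ConvexCone ℝ E) : Prop where
  isOpen : IsOpen (C : Set E)
  proper : closure (C : Set E) ∩ -closure (C : Set E) = {0}

/-- The set of points of the cone `C`. This is a copy of the subtype, so that it carries the order
of the closed cone and the topology of the Thompson metric (and no other structure) below. -/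
def ConePoint (C : ConvexCone ℝ E) : Type _ := {x : E // x ∈ C}

namespace ConePoint

variable {C : ConvexCone ℝ E}

/-- The order defined by the closed cone: `x ≤ y` iff `y - x ∈ closure C`. -/
instance : LE (ConePoint C) := ⟨fun x y => y.1 - x.1 ∈ closure (C : Set E)⟩

/-- `M(x/y) = inf {t > 0 : x ≤ t y}`. -/
noncomputable def gauge (x y : ConePoint C) : ℝ :=
  sInf {t : ℝ | 0 < t ∧ t • y.1 - x.1 ∈ closure (C : Set E)}

/-- The Thompson part metric `d_T(x,y) = max {log M(x/y), log M(y/x)}`. -/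
noncomputable def thompsonDist (x y : ConePoint C) : ℝ :=
  max (Real.log (gauge x y)) (Real.log (gauge y x))

/-- The metric topology of `d_T`: a set is open iff with each of its points it contains a
`d_T`-ball around that point. -/
instance : TopologicalSpace (ConePoint C) where
  IsOpen U := ∀ x ∈ U, ∃ ε : ℝ, 0 < ε ∧ ∀ y : ConePoint C, thompsonDist x y < ε → y ∈ U
  isOpen_univ := fun _ _ => ⟨1, one_pos, fun _ _ => Set.mem_univ _⟩
  isOpen_inter := fun U V hU hV x hx => by
    obtain ⟨a, ha, hau⟩ := hU x hx.1
    obtain ⟨b, hb, hbv⟩ := hV x hx.2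
    exact ⟨min a b, lt_min ha hb, fun y hy =>
      ⟨hau y (hy.trans_le (min_le_left _ _)), hbv y (hy.trans_le (min_le_right _ _))⟩⟩
  isOpen_sUnion := fun S hS x hx => by
    obtain ⟨U, hU, hxU⟩ := hx
    obtain ⟨a, ha, hau⟩ := hS U hU x hxU
    exact ⟨a, ha, fun y hy => ⟨U, hU, hau y hy⟩⟩

/-- The Borel algebra of `C`. -/
instance : MeasurableSpace (ConePoint C) := borel (ConePoint C)

instance : BorelSpace (ConePoint C) := ⟨rfl⟩

end ConePoint

end Cone

/-!
Both halves have the same proof.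

The Thompson metric induces the norm topology on the cone (`ConePoint.isOpenEmbedding_val`). This
rests on normality of a closed proper cone in finite dimension (`IsOpenProperCone.exists_norm_le`),
which also makes order intervals compact (`ConePoint.isCompact_orderInterval`). A set of probability
measures lying between `α` and `β` in the stochastic order is therefore tight: `α` prevents mass from
escaping to the boundary of the cone and `β` prevents it from escaping to infinity
(`StochLE.isTightMeasureSet`). By Prokhorov's theorem, a monotone bounded sequence has a weak cluster
point.

The stochastic order is closed under weak limits (`StochLE.of_tendsto_le`, `StochLE.of_le_tendsto`).
Upper bounds on the limit are the portmanteau inequality on open sets. For lower bounds, an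
open upper set `U` is exhausted by the upper sets `r⁻¹ • U`, `r < 1`, whose closures are still
contained in `U`. The order is also antisymmetric, because the open upper sets are a π-system
generating the Borel σ-algebra (`ConePoint.borel_eq_generateFrom_isUpperSet`). A cluster point of an
increasing sequence is thus its least upper bound, so the cluster point is unique and the sequence
converges to it; decreasing sequences are dual.
-/

/-! ### The closed cone and the topology of the Thompson metric -/

section Cone

variable {E : Type*} [NormedAddCommGroup E] [NormedSpace ℝ E] {C : ConvexCone ℝ E}

namespace IsOpenProperCone

lemma zero_mem_closure (hC : IsOpenProperCone C) : (0 : E) ∈ closure (C : Set E) :=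
  (hC.proper.ge rfl : (0 : E) ∈ closure (C : Set E) ∩ -closure (C : Set E)).1

lemma eq_zero (hC : IsOpenProperCone C) {x : E} (hx : x ∈ closure (C : Set E))
    (hx' : -x ∈ closure (C : Set E)) : x = 0 :=
  hC.proper.le ⟨hx, hx'⟩

lemma add_mem_closure {x y : E} (hx : x ∈ closure (C : Set E)) (hy : y ∈ closure (C : Set E)) :
    x + y ∈ closure (C : Set E) :=
  C.closure.add_mem hx hy

lemma smul_mem_closure (hC : IsOpenProperCone C) {t : ℝ} (ht : 0 ≤ t) {x : E}
    (hx : x ∈ closure (C : Set E)) : t • x ∈ closure (C : Set E) := by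
  rcases ht.eq_or_lt with rfl | ht
  · simpa using hC.zero_mem_closure
  · exact C.closure.smul_mem ht hx

/-- Adding a point of the closed cone to a point of the open cone stays in the open cone. -/
lemma add_mem (hC : IsOpenProperCone C) {x y : E} (hx : x ∈ closure (C : Set E))
    (hy : y ∈ C) : x + y ∈ C := by
  have ho : IsOpen {z : E | y + (x - z) ∈ (C : Set E)} := hC.isOpen.preimage (by fun_prop)
  obtain ⟨z, hz, hzC⟩ := mem_closure_iff.1 hx _ ho (by simpa using hy)
  have := C.add_mem hz hzC
  rwa [show y + (x - z) + z = x + y by abel] at this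

/-- The norm is, up to a constant, monotone on the closed cone. In finite dimension this follows
from compactness: the distance to `-closure C` has a positive minimum on the unit vectors of
`closure C`. -/
lemma exists_norm_le [FiniteDimensional ℝ E] (hC : IsOpenProperCone C) :
    ∃ M : ℝ, 0 < M ∧ ∀ x y : E, x ∈ closure (C : Set E) → y - x ∈ closure (C : Set E) →
      ‖x‖ ≤ M * ‖y‖ := by
  have : ProperSpace E := FiniteDimensional.proper ℝ E
  have hne : (-closure (C : Set E)).Nonempty := ⟨0, by simpa using hC.zero_mem_closure⟩
  have hcl : IsClosed (-closure (C : Set E)) := isClosed_closure.neg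
  have hS : IsCompact (closure (C : Set E) ∩ Metric.sphere 0 1) :=
    (isCompact_sphere 0 1).inter_left isClosed_closure
  have hpos : ∀ x ∈ closure (C : Set E) ∩ Metric.sphere 0 1,
      0 < Metric.infDist x (-closure (C : Set E)) := by
    rintro x ⟨hx, hx1⟩
    refine (hcl.notMem_iff_infDist_pos hne).1 fun h => ?_
    have := hC.eq_zero hx h
    simp [this] at hx1
  obtain ⟨c, hc, hcS⟩ : ∃ c : ℝ, 0 < c ∧ ∀ x ∈ closure (C : Set E) ∩ Metric.sphere 0 1,
      c ≤ Metric.infDist x (-closure (C : Set E)) := by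
    rcases (closure (C : Set E) ∩ Metric.sphere 0 1).eq_empty_or_nonempty with h | h
    · exact ⟨1, one_pos, by simp [h]⟩
    · obtain ⟨x, hx, hmin⟩ := hS.exists_isMinOn h (Metric.continuous_infDist_pt _).continuousOn
      exact ⟨_, hpos x hx, fun y hy => hmin hy⟩
  refine ⟨c⁻¹, inv_pos.2 hc, fun x y hx hxy => ?_⟩
  rcases eq_or_ne x 0 with rfl | hx0
  · simp only [norm_zero]; positivity
  have hn : 0 < ‖x‖ := norm_pos_iff.2 hx0
  have h1 := hcS (‖x‖⁻¹ • x) ⟨hC.smul_mem_closure (by positivity) hx, by simp [norm_smul, hn.ne']⟩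
  have h2 : Metric.infDist (‖x‖⁻¹ • x) (-closure (C : Set E)) ≤
      dist (‖x‖⁻¹ • x) (-(‖x‖⁻¹ • (y - x))) :=
    Metric.infDist_le_dist_of_mem
      (by simpa only [Set.mem_neg, neg_neg] using hC.smul_mem_closure (by positivity) hxy)
  have h3 : dist (‖x‖⁻¹ • x) (-(‖x‖⁻¹ • (y - x))) = ‖x‖⁻¹ * ‖y‖ := by
    rw [dist_eq_norm, sub_neg_eq_add, ← smul_add, add_sub_cancel, norm_smul, norm_inv, norm_norm]
  rw [h3] at h2
  have h4 := h1.trans h2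
  rw [inv_mul_eq_div, le_div_iff₀ hn] at h4
  rwa [inv_mul_eq_div, le_div_iff₀ hc, mul_comm]

end IsOpenProperCone

namespace ConePoint

lemma le_def {x y : ConePoint C} : x ≤ y ↔ y.1 - x.1 ∈ closure (C : Set E) := Iff.rfl

lemma gauge_nonneg (x y : ConePoint C) : 0 ≤ gauge x y :=
  Real.sInf_nonneg fun _ ht => ht.1.le

/-- When `gauge x y = 0`, which happens in dimension zero, the junk value `log 0 = 0` is harmless
because `1 ≤ t`. -/
lemma log_gauge_le {x y : ConePoint C} {t : ℝ} (ht : 1 ≤ t)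
    (h : t • y.1 - x.1 ∈ closure (C : Set E)) : Real.log (gauge x y) ≤ Real.log t := by
  have hle : gauge x y ≤ t := csInf_le ⟨0, fun _ hs => hs.1.le⟩ ⟨by linarith, h⟩
  rcases (gauge_nonneg x y).eq_or_lt with h0 | h0
  · rw [← h0, Real.log_zero]; exact Real.log_nonneg ht
  · exact Real.log_le_log h0 hle

/-- Every point of the cone lies below a multiple of any other one, so the set whose infimum
defines `gauge` is nonempty. -/
lemma exists_smul_sub_mem (hC : IsOpenProperCone C) (x : E) (y : ConePoint C) :
    ∃ n : ℕ, 0 < n ∧ ∀ m ≥ n, (m : ℝ) • y.1 - x ∈ C := by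
  have hlim : Tendsto (fun n : ℕ => y.1 - (n : ℝ)⁻¹ • x) atTop (𝓝 y.1) := by
    simpa using (tendsto_inv_atTop_nhds_zero_nat (𝕜 := ℝ)).smul_const x |>.const_sub y.1
  have hev := hlim.eventually (hC.isOpen.mem_nhds y.2)
  obtain ⟨N, hN⟩ := eventually_atTop.1 hev
  refine ⟨N + 1, by omega, fun m hm => ?_⟩
  have hm0 : (0 : ℝ) < m := by exact_mod_cast (by omega : 0 < m)
  have := C.smul_mem hm0 (hN m (by omega))
  rwa [smul_sub, smul_inv_smul₀ hm0.ne'] at this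

lemma smul_sub_mem_of_log_gauge_lt (hC : IsOpenProperCone C) {x y : ConePoint C} {t : ℝ}
    (ht : 0 < t) (h : Real.log (gauge x y) < Real.log t) :
    t • y.1 - x.1 ∈ closure (C : Set E) := by
  have hlt : gauge x y < t := by
    rcases (gauge_nonneg x y).eq_or_lt with h0 | h0
    · rwa [← h0]
    · exact (Real.log_lt_log_iff h0 ht).1 h
  obtain ⟨n, hn, hm⟩ := exists_smul_sub_mem hC x.1 y
  have hne : {s : ℝ | 0 < s ∧ s • y.1 - x.1 ∈ closure (C : Set E)}.Nonempty :=
    ⟨(n : ℝ), by exact_mod_cast hn, subset_closure (hm n le_rfl)⟩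
  obtain ⟨s, ⟨-, hs⟩, hst⟩ := exists_lt_of_csInf_lt hne hlt
  have := IsOpenProperCone.add_mem_closure hs
    (hC.smul_mem_closure (sub_nonneg.2 hst.le) (subset_closure y.2))
  rwa [sub_smul, sub_add_sub_cancel'] at this

/-- The points `y` with `t⁻¹ x ≤ y ≤ t x` are norm-close to `x` when `t > 1` is close to `1`. -/
lemma exists_norm_sub_lt [FiniteDimensional ℝ E] (hC : IsOpenProperCone C) (x : E)
    {δ : ℝ} (hδ : 0 < δ) :
    ∃ t : ℝ, 1 < t ∧ ∀ y : E, t • y - x ∈ closure (C : Set E) →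
      t • x - y ∈ closure (C : Set E) → ‖y - x‖ < δ := by
  obtain ⟨M, hM, hMle⟩ := hC.exists_norm_le
  have hcont : ContinuousAt
      (fun t : ℝ => M * ((t - t⁻¹) * ‖x‖) + (1 - t⁻¹) * ‖x‖) 1 := by
    fun_prop (disch := norm_num)
  have hev : ∀ᶠ t in 𝓝[>] (1 : ℝ), M * ((t - t⁻¹) * ‖x‖) + (1 - t⁻¹) * ‖x‖ < δ :=
    nhdsWithin_le_nhds (hcont.eventually_lt continuousAt_const (by simpa using hδ))
  obtain ⟨t, htδ, ht1⟩ := (hev.and self_mem_nhdsWithin).exists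
  replace ht1 : 1 < t := ht1
  have ht0 : 0 < t := by linarith
  have htinv : t⁻¹ < 1 := inv_lt_one_of_one_lt₀ ht1
  refine ⟨t, ht1, fun y h1 h2 => lt_of_le_of_lt ?_ htδ⟩
  have hy : y - t⁻¹ • x ∈ closure (C : Set E) := by
    have := hC.smul_mem_closure (inv_nonneg.2 ht0.le) h1
    rwa [smul_sub, inv_smul_smul₀ ht0.ne'] at this
  have h3 := hMle (y - t⁻¹ • x) ((t - t⁻¹) • x) hy
    (by rwa [sub_smul, sub_sub_sub_cancel_right])
  rw [norm_smul, Real.norm_of_nonneg (by linarith)] at h3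
  calc ‖y - x‖ = ‖(y - t⁻¹ • x) - (1 - t⁻¹) • x‖ := by
        rw [sub_smul, one_smul]; congr 1; abel
    _ ≤ ‖y - t⁻¹ • x‖ + ‖(1 - t⁻¹) • x‖ := norm_sub_le _ _
    _ ≤ _ := by
        rw [norm_smul (1 - t⁻¹), Real.norm_of_nonneg (by linarith)]; gcongr

lemma exists_thompsonDist_lt (hC : IsOpenProperCone C) (x : ConePoint C) {ε : ℝ} (hε : 0 < ε) :
    ∃ δ > 0, ∀ y : ConePoint C, ‖y.1 - x.1‖ < δ → thompsonDist x y < ε := by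
  have ht : 1 < Real.exp (ε / 2) := Real.one_lt_exp_iff.2 (by positivity)
  set t := Real.exp (ε / 2)
  have hx : t • x.1 - x.1 ∈ C := by
    have := C.smul_mem (sub_pos.2 ht) x.2
    rwa [sub_smul, one_smul] at this
  have ho : IsOpen {y : E | t • y - x.1 ∈ (C : Set E) ∧ t • x.1 - y ∈ (C : Set E)} :=
    (hC.isOpen.preimage (by fun_prop)).inter (hC.isOpen.preimage (by fun_prop))
  obtain ⟨δ, hδ, hball⟩ := Metric.isOpen_iff.1 ho x.1 ⟨hx, hx⟩
  refine ⟨δ, hδ, fun y hy => ?_⟩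
  obtain ⟨h1, h2⟩ := hball (mem_ball_iff_norm.2 hy)
  have hlog : Real.log t = ε / 2 := Real.log_exp _
  refine lt_of_le_of_lt (max_le (log_gauge_le ht.le (subset_closure h1))
    (log_gauge_le ht.le (subset_closure h2))) (by linarith)

/-- In finite dimension the Thompson metric induces the norm topology of the cone. -/
lemma isOpenEmbedding_val [FiniteDimensional ℝ E] (hC : IsOpenProperCone C) :
    IsOpenEmbedding (fun x : ConePoint C => x.1) := by
  have himage : ∀ U : Set (ConePoint C), IsOpen U → IsOpen ((fun x : ConePoint C => x.1) '' U) := by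
    intro U hU
    rw [Metric.isOpen_iff]
    rintro _ ⟨x, hx, rfl⟩
    obtain ⟨ε, hε, hεU⟩ := hU x hx
    obtain ⟨δ, hδ, hd⟩ := exists_thompsonDist_lt hC x hε
    obtain ⟨δ', hδ', hd'⟩ := Metric.isOpen_iff.1 hC.isOpen x.1 x.2
    refine ⟨min δ δ', lt_min hδ hδ', fun y hy => ?_⟩
    rw [mem_ball_iff_norm, lt_min_iff] at hy
    exact ⟨⟨y, hd' (mem_ball_iff_norm.2 hy.2)⟩, hεU _ (hd _ hy.1), rfl⟩
  refine .of_continuous_injective_isOpenMap ⟨fun V hV x hx => ?_⟩ Subtype.val_injective himage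
  obtain ⟨δ, hδ, hδV⟩ := Metric.isOpen_iff.1 hV x.1 hx
  obtain ⟨t, ht, hnear⟩ := exists_norm_sub_lt hC x.1 hδ
  have ht0 : 0 < t := by linarith
  refine ⟨Real.log t, Real.log_pos ht, fun y hy => hδV (mem_ball_iff_norm.2 ?_)⟩
  obtain ⟨h1, h2⟩ := max_lt_iff.1 hy
  exact hnear y.1 (smul_sub_mem_of_log_gauge_lt hC ht0 h1)
    (smul_sub_mem_of_log_gauge_lt hC ht0 h2)

end ConePoint

end Cone

/-! ### Open upper sets -/

section StochOrder

variable {E : Type*} [NormedAddCommGroup E] [NormedSpace ℝ E] {C : ConvexCone ℝ E}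

namespace ConePoint

/-- Multiplication of a point of the cone by a positive scalar. -/
def scale (r : ℝ) (hr : 0 < r) (x : ConePoint C) : ConePoint C := ⟨r • x.1, C.smul_mem hr x.2⟩

/-- The pullback of `U` under multiplication by `r`, that is `r⁻¹ • U` when `r > 0`; it is empty
when `r • C` misses `U`, so no sign condition on `r` is needed. -/
def dilate (r : ℝ) (U : Set (ConePoint C)) : Set (ConePoint C) :=
  {z | ∃ w ∈ U, w.1 = r • z.1}

lemma isUpperSet_dilate (hC : IsOpenProperCone C) {r : ℝ} (hr : 0 < r) {U : Set (ConePoint C)}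
    (hU : IsUpperSet U) : IsUpperSet (dilate r U) := by
  rintro x y hxy ⟨w, hw, hwx⟩
  refine ⟨scale r hr y, hU (a := w) ?_ hw, rfl⟩
  have := hC.smul_mem_closure hr.le (le_def.1 hxy)
  rwa [smul_sub, ← hwx] at this

lemma dilate_mono (hC : IsOpenProperCone C) {r s : ℝ} (hr : 0 < r) (hrs : r ≤ s)
    {U : Set (ConePoint C)} (hU : IsUpperSet U) : dilate r U ⊆ dilate s U := by
  rintro x ⟨w, hw, hwx⟩
  refine ⟨scale s (hr.trans_le hrs) x, hU (a := w) ?_ hw, rfl⟩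
  have := hC.smul_mem_closure (sub_nonneg.2 hrs) (subset_closure x.2)
  rwa [sub_smul, ← hwx] at this

lemma isUpperSet_setOf_sub_mem (hC : IsOpenProperCone C) (a : E) :
    IsUpperSet {z : ConePoint C | z.1 - a ∈ C} :=
  fun x y hxy h => by
    have := hC.add_mem (le_def.1 hxy) h
    rwa [sub_add_sub_cancel] at this

lemma isUpperSet_compl_setOf_sub_mem (b : E) :
    IsUpperSet {z : ConePoint C | b - z.1 ∈ closure (C : Set E)}ᶜ := by
  intro x y hxy h hy
  refine h ?_
  have := IsOpenProperCone.add_mem_closure (C := C) hy (le_def.1 hxy)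
  rwa [sub_add_sub_cancel] at this

variable [FiniteDimensional ℝ E]

lemma continuous_val (hC : IsOpenProperCone C) : Continuous (fun x : ConePoint C => x.1) :=
  (isOpenEmbedding_val hC).continuous

lemma isOpen_dilate (hC : IsOpenProperCone C) {r : ℝ} {U : Set (ConePoint C)}
    (hU : IsOpen U) : IsOpen (dilate r U) := by
  have : dilate r U = (fun z : ConePoint C => r • z.1) ⁻¹' ((fun x : ConePoint C => x.1) '' U) :=
    rfl
  rw [this]
  exact ((isOpenEmbedding_val hC).isOpenMap U hU).preimage ((continuous_val hC).const_smul r)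

lemma isOpen_setOf_sub_mem (hC : IsOpenProperCone C) (a : E) :
    IsOpen {z : ConePoint C | z.1 - a ∈ C} :=
  hC.isOpen.preimage ((continuous_val hC).sub continuous_const)

lemma isClosed_setOf_sub_mem (hC : IsOpenProperCone C) (b : E) :
    IsClosed {z : ConePoint C | b - z.1 ∈ closure (C : Set E)} :=
  isClosed_closure.preimage (continuous_const.sub (continuous_val hC))

/-- This is what lets open upper sets play the role of continuity sets: shrinking an upper set by a
factor `r < 1` makes its closure fit inside the original set. -/
lemma closure_dilate_subset (hC : IsOpenProperCone C) {r : ℝ} (hr : r < 1)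
    {U : Set (ConePoint C)} (hU : IsUpperSet U) : closure (dilate r U) ⊆ U := by
  intro z hz
  have hopen : IsOpen {w : ConePoint C | z.1 - r • w.1 ∈ C} :=
    hC.isOpen.preimage (continuous_const.sub ((continuous_val hC).const_smul r))
  have hzmem : z.1 - r • z.1 ∈ C := by
    have := C.smul_mem (sub_pos.2 hr) z.2
    rwa [sub_smul, one_smul] at this
  obtain ⟨w, hw, v, hv, hvw⟩ := mem_closure_iff.1 hz _ hopen hzmem
  refine hU (a := v) ?_ hv
  rw [le_def, hvw]
  exact subset_closure hw

/-- An open upper set is the increasing limit of its shrinkings by factors `r < 1`. -/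
lemma measure_le_of_forall_dilate (hC : IsOpenProperCone C) (ρ : Measure (ConePoint C))
    {U : Set (ConePoint C)} (hUo : IsOpen U) (hU : IsUpperSet U) {c : ENNReal}
    (h : ∀ r : ℝ, 0 < r → r < 1 → ρ (dilate r U) ≤ c) : ρ U ≤ c := by
  obtain ⟨r, hr_mono, hr, hr_lim⟩ := exists_seq_strictMono_tendsto' (zero_lt_one (α := ℝ))
  have hmono : Monotone fun n => dilate (r n) U :=
    fun m n hmn => dilate_mono hC (hr m).1 (hr_mono.monotone hmn) hU
  have hsub : U ⊆ ⋃ n, dilate (r n) U := by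
    intro z hz
    have hlim : Tendsto (fun n => r n • z.1) atTop (𝓝 z.1) := by
      simpa using hr_lim.smul_const z.1
    have hmem : (fun x : ConePoint C => x.1) '' U ∈ 𝓝 z.1 :=
      ((isOpenEmbedding_val hC).isOpenMap U hUo).mem_nhds ⟨z, hz, rfl⟩
    obtain ⟨n, hn⟩ := (hlim.eventually hmem).exists
    exact Set.mem_iUnion.2 ⟨n, hn⟩
  exact (measure_mono hsub).trans
    (le_of_tendsto' (tendsto_measure_iUnion_atTop hmono) fun n => h _ (hr n).1 (hr n).2)

/-- The open order intervals `(t⁻¹ x, t x)` are the Thompson balls around `x`. -/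
lemma isTopologicalBasis_orderInterval (hC : IsOpenProperCone C) :
    TopologicalSpace.IsTopologicalBasis
      {S : Set (ConePoint C) | ∃ a b : ConePoint C,
        S = {z | z.1 - a.1 ∈ C} ∩ {z | b.1 - z.1 ∈ C}} := by
  refine TopologicalSpace.isTopologicalBasis_of_isOpen_of_nhds ?_ fun x U hx hU => ?_
  · rintro _ ⟨a, b, rfl⟩
    exact (isOpen_setOf_sub_mem hC _).inter
      (hC.isOpen.preimage (continuous_const.sub (continuous_val hC)))
  obtain ⟨δ, hδ, hδU⟩ := Metric.isOpen_iff.1 ((isOpenEmbedding_val hC).isOpenMap U hU) x.1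
    ⟨x, hx, rfl⟩
  obtain ⟨t, ht, hnear⟩ := exists_norm_sub_lt hC x.1 hδ
  have ht0 : 0 < t := by linarith
  refine ⟨_, ⟨scale t⁻¹ (inv_pos.2 ht0) x, scale t ht0 x, rfl⟩,
    ⟨?_, ?_⟩, ?_⟩
  · have := C.smul_mem (sub_pos.2 (inv_lt_one_of_one_lt₀ ht)) x.2
    rwa [sub_smul, one_smul] at this
  · have := C.smul_mem (sub_pos.2 ht) x.2
    rwa [sub_smul, one_smul] at this
  · rintro y ⟨hy1, hy2⟩
    have h1 : t • y.1 - x.1 ∈ C := by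
      have : t • (y.1 - t⁻¹ • x.1) ∈ C := C.smul_mem ht0 hy1
      rwa [smul_sub, smul_inv_smul₀ ht0.ne'] at this
    obtain ⟨y', hy', hyy'⟩ := hδU (mem_ball_iff_norm.2
      (hnear y.1 (subset_closure h1) (subset_closure hy2)))
    rwa [← Subtype.val_injective hyy']

lemma secondCountableTopology (hC : IsOpenProperCone C) :
    SecondCountableTopology (ConePoint C) :=
  (isOpenEmbedding_val hC).isEmbedding.secondCountableTopology

lemma metrizableSpace (hC : IsOpenProperCone C) :
    TopologicalSpace.MetrizableSpace (ConePoint C) :=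
  (isOpenEmbedding_val hC).isEmbedding.metrizableSpace

/-- The open upper sets generate the Borel σ-algebra: it is generated by open order intervals, and
the open lower set below `b` is the union of the closed lower sets below the points `r b`, `r < 1`,
whose complements are open upper sets. -/
lemma borel_eq_generateFrom_isUpperSet (hC : IsOpenProperCone C) :
    borel (ConePoint C) =
      MeasurableSpace.generateFrom {U : Set (ConePoint C) | IsOpen U ∧ IsUpperSet U} := by
  have := secondCountableTopology hC
  refine le_antisymm ?_ ?_
  · rw [(isTopologicalBasis_orderInterval hC).borel_eq_generateFrom]
    refine MeasurableSpace.generateFrom_le ?_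
    rintro _ ⟨a, b, rfl⟩
    refine MeasurableSet.inter (MeasurableSpace.measurableSet_generateFrom
      ⟨isOpen_setOf_sub_mem hC _, isUpperSet_setOf_sub_mem hC _⟩) ?_
    obtain ⟨r, -, hr, hr_lim⟩ := exists_seq_strictMono_tendsto' (zero_lt_one (α := ℝ))
    have heq : {z : ConePoint C | b.1 - z.1 ∈ C} =
        ⋃ n, {z : ConePoint C | r n • b.1 - z.1 ∈ closure (C : Set E)} := by
      ext z
      simp only [Set.mem_ofPred_eq, Set.mem_iUnion]
      constructor
      · intro hz
        have hlim : Tendsto (fun n => r n • b.1 - z.1) atTop (𝓝 (b.1 - z.1)) := by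
          simpa using (hr_lim.smul_const b.1).sub_const z.1
        obtain ⟨n, hn⟩ := (hlim.eventually (hC.isOpen.mem_nhds hz)).exists
        exact ⟨n, subset_closure hn⟩
      · rintro ⟨n, hn⟩
        have := hC.add_mem hn (C.smul_mem (sub_pos.2 (hr n).2) b.2)
        rwa [sub_smul, one_smul, add_comm, sub_add_sub_cancel] at this
    rw [heq]
    refine MeasurableSet.iUnion fun n => MeasurableSet.of_compl
      (MeasurableSpace.measurableSet_generateFrom
        ⟨(isClosed_setOf_sub_mem hC _).isOpen_compl, isUpperSet_compl_setOf_sub_mem _⟩)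
  · exact MeasurableSpace.generateFrom_mono fun U hU => hU.1

end ConePoint

/-! ### Antisymmetry and closedness of the stochastic order -/

namespace StochLE

lemma refl {X : Type*} [TopologicalSpace X] [MeasurableSpace X] [LE X]
    (μ : ProbabilityMeasure X) : StochLE μ μ := fun _ _ _ => le_rfl

lemma trans {X : Type*} [TopologicalSpace X] [MeasurableSpace X] [LE X]
    {μ ν ρ : ProbabilityMeasure X} (h : StochLE μ ν) (h' : StochLE ν ρ) : StochLE μ ρ :=
  fun U hU hU' => (h U hU hU').trans (h' U hU hU')

lemma of_forall_le_succ {X : Type*} [TopologicalSpace X] [MeasurableSpace X] [LE X]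
    {μs : ℕ → ProbabilityMeasure X} (h : ∀ n, StochLE (μs n) (μs (n + 1))) {m n : ℕ}
    (hmn : m ≤ n) : StochLE (μs m) (μs n) := by
  induction n, hmn using Nat.le_induction with
  | base => exact refl _
  | succ n _ ih => exact ih.trans (h n)

lemma of_forall_succ_le {X : Type*} [TopologicalSpace X] [MeasurableSpace X] [LE X]
    {μs : ℕ → ProbabilityMeasure X} (h : ∀ n, StochLE (μs (n + 1)) (μs n)) {m n : ℕ}
    (hmn : m ≤ n) : StochLE (μs n) (μs m) := by
  induction n, hmn using Nat.le_induction with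
  | base => exact refl _
  | succ n _ ih => exact (h n).trans ih

variable [FiniteDimensional ℝ E] {ι : Type*} {L : Filter ι} [L.NeBot]
  {μs : ι → ProbabilityMeasure (ConePoint C)} {μ ρ : ProbabilityMeasure (ConePoint C)}

/-- Open upper sets form a π-system generating the Borel σ-algebra, so they determine a probability
measure. -/
lemma antisymm (hC : IsOpenProperCone C) (h : StochLE μ ρ) (h' : StochLE ρ μ) : μ = ρ := by
  refine Subtype.ext ?_
  change (μ : Measure (ConePoint C)) = (ρ : Measure (ConePoint C))
  refine ext_of_generate_finite _
    (ConePoint.borel_eq_generateFrom_isUpperSet hC) ?_ ?_ (by simp)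
  · rintro U ⟨hU, hU'⟩ V ⟨hV, hV'⟩ -
    exact ⟨hU.inter hV, hU'.inter hV'⟩
  · rintro U ⟨hU, hU'⟩
    exact le_antisymm (h U hU hU') (h' U hU hU')

lemma of_tendsto_le (hC : IsOpenProperCone C) (hlim : Tendsto μs L (𝓝 μ))
    (h : ∀ᶠ i in L, StochLE (μs i) ρ) : StochLE μ ρ := by
  have := ConePoint.metrizableSpace hC
  intro U hU hU'
  calc (μ : Measure (ConePoint C)) U
      ≤ L.liminf fun i => (μs i : Measure (ConePoint C)) U :=
        ProbabilityMeasure.le_liminf_measure_open_of_tendsto hlim hU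
    _ ≤ L.limsup fun i => (μs i : Measure (ConePoint C)) U := liminf_le_limsup
    _ ≤ (ρ : Measure (ConePoint C)) U := limsup_le_of_le (h := h.mono fun i hi => hi U hU hU')

/-- The portmanteau theorem bounds the limit from below only on closed sets; the closures of the
shrinkings of an open upper set `U` lie in `U` and exhaust it. -/
lemma of_le_tendsto (hC : IsOpenProperCone C) (hlim : Tendsto μs L (𝓝 μ))
    (h : ∀ᶠ i in L, StochLE ρ (μs i)) : StochLE ρ μ := by
  have := ConePoint.metrizableSpace hC
  intro U hU hU'
  refine ConePoint.measure_le_of_forall_dilate hC _ hU hU' fun r hr hr1 => ?_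
  calc (ρ : Measure (ConePoint C)) (ConePoint.dilate r U)
      ≤ L.liminf fun i => (μs i : Measure (ConePoint C)) (closure (ConePoint.dilate r U)) :=
        le_liminf_of_le (h := h.mono fun i hi =>
          (hi _ (ConePoint.isOpen_dilate hC hU) (ConePoint.isUpperSet_dilate hC hr hU')).trans
            (measure_mono subset_closure))
    _ ≤ L.limsup fun i => (μs i : Measure (ConePoint C)) (closure (ConePoint.dilate r U)) :=
        liminf_le_limsup
    _ ≤ (μ : Measure (ConePoint C)) (closure (ConePoint.dilate r U)) :=
        ProbabilityMeasure.limsup_measure_closed_le_of_tendsto hlim isClosed_closure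
    _ ≤ (μ : Measure (ConePoint C)) U :=
        measure_mono (ConePoint.closure_dilate_subset hC hr1 hU')

end StochLE

end StochOrder

/-! ### Tightness and convergence -/

section Convergence

variable {E : Type*} [NormedAddCommGroup E] [NormedSpace ℝ E] {C : ConvexCone ℝ E}
  [FiniteDimensional ℝ E]

namespace ConePoint

lemma isCompact_orderInterval (hC : IsOpenProperCone C) (a b : ConePoint C) :
    IsCompact {z : ConePoint C | a ≤ z ∧ z ≤ b} := by
  have : ProperSpace E := FiniteDimensional.proper ℝ E
  obtain ⟨M, hM, hMle⟩ := hC.exists_norm_le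
  rw [(isOpenEmbedding_val hC).isEmbedding.isCompact_iff]
  have heq : (fun x : ConePoint C => x.1) '' {z | a ≤ z ∧ z ≤ b} =
      {z : E | z - a.1 ∈ closure (C : Set E) ∧ b.1 - z ∈ closure (C : Set E)} := by
    ext z
    constructor
    · rintro ⟨z, hz, rfl⟩
      exact hz
    · rintro ⟨h1, h2⟩
      have hz : z ∈ C := by simpa using hC.add_mem h1 a.2
      exact ⟨⟨z, hz⟩, ⟨h1, h2⟩, rfl⟩
  rw [heq]
  refine Metric.isCompact_of_isClosed_isBounded
    ((isClosed_closure.preimage (by fun_prop)).inter (isClosed_closure.preimage (by fun_prop)))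
    (isBounded_iff_forall_norm_le.2 ⟨M * ‖b.1‖, ?_⟩)
  rintro z ⟨h1, h2⟩
  exact hMle z b.1 (subset_closure (by simpa using hC.add_mem h1 a.2)) h2

/-- The sets of points above small multiples of `u` exhaust the cone. -/
lemma exists_measure_compl_above_le (hC : IsOpenProperCone C)
    (α : ProbabilityMeasure (ConePoint C)) (u : ConePoint C) {ε : ENNReal} (hε : 0 < ε) :
    ∃ r : ℝ, 0 < r ∧ (α : Measure (ConePoint C)) {z | z.1 - r • u.1 ∈ C}ᶜ ≤ ε := by
  obtain ⟨r, hr_anti, hr, hr_lim⟩ := exists_seq_strictAnti_tendsto (0 : ℝ)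
  have hlim := tendsto_measure_iInter_atTop (μ := (α : Measure (ConePoint C)))
    (s := fun n => {z : ConePoint C | z.1 - r n • u.1 ∈ C}ᶜ)
    (fun n => (isOpen_setOf_sub_mem hC _).measurableSet.compl.nullMeasurableSet)
    (fun m n hmn z hz hz' => hz ?_) ⟨0, measure_ne_top _ _⟩
  · have hempty : ⋂ n, {z : ConePoint C | z.1 - r n • u.1 ∈ C}ᶜ = ∅ := by
      refine Set.eq_empty_of_forall_notMem fun z hz => ?_
      have hz_lim : Tendsto (fun n => z.1 - r n • u.1) atTop (𝓝 z.1) := by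
        simpa using (hr_lim.smul_const u.1).const_sub z.1
      obtain ⟨n, hn⟩ := (hz_lim.eventually (hC.isOpen.mem_nhds z.2)).exists
      exact Set.mem_iInter.1 hz n hn
    rw [hempty, measure_empty] at hlim
    obtain ⟨n, hn⟩ := (hlim.eventually (gt_mem_nhds hε)).exists
    exact ⟨r n, hr n, hn.le⟩
  · have := hC.add_mem (hC.smul_mem_closure (sub_nonneg.2 (hr_anti.antitone hmn))
      (subset_closure u.2)) hz'
    rwa [sub_smul, add_comm, sub_add_sub_cancel] at this

/-- The sets of points below large multiples of `u` exhaust the cone. -/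
lemma exists_measure_compl_below_le (hC : IsOpenProperCone C)
    (β : ProbabilityMeasure (ConePoint C)) (u : ConePoint C) {ε : ENNReal} (hε : 0 < ε) :
    ∃ R : ℝ, 0 < R ∧
      (β : Measure (ConePoint C)) {z | R • u.1 - z.1 ∈ closure (C : Set E)}ᶜ ≤ ε := by
  have hlim := tendsto_measure_iInter_atTop (μ := (β : Measure (ConePoint C)))
    (s := fun n : ℕ => {z : ConePoint C | (n : ℝ) • u.1 - z.1 ∈ closure (C : Set E)}ᶜ)
    (fun n => (isClosed_setOf_sub_mem hC _).measurableSet.compl.nullMeasurableSet)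
    (fun m n hmn z hz hz' => hz ?_) ⟨0, measure_ne_top _ _⟩
  · have hempty :
        ⋂ n : ℕ, {z : ConePoint C | (n : ℝ) • u.1 - z.1 ∈ closure (C : Set E)}ᶜ = ∅ := by
      refine Set.eq_empty_of_forall_notMem fun z hz => ?_
      obtain ⟨n, -, hn⟩ := exists_smul_sub_mem hC z.1 u
      exact Set.mem_iInter.1 hz n (subset_closure (hn n le_rfl))
    rw [hempty, measure_empty] at hlim
    obtain ⟨n, hn, hn0⟩ := ((hlim.eventually (gt_mem_nhds hε)).and (eventually_gt_atTop 0)).exists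
    exact ⟨n, by exact_mod_cast hn0, hn.le⟩
  · have := IsOpenProperCone.add_mem_closure (hC.smul_mem_closure
      (sub_nonneg.2 (Nat.cast_le (α := ℝ).2 hmn)) (subset_closure u.2)) hz'
    rwa [sub_smul, sub_add_sub_cancel] at this

end ConePoint

namespace StochLE

/-- An order-bounded set of probability measures is tight: the lower bound controls the mass near
the boundary of the cone, the upper bound controls the mass near infinity, and what remains is a
compact order interval. -/
lemma isTightMeasureSet (hC : IsOpenProperCone C) {α β : ProbabilityMeasure (ConePoint C)}
    {S : Set (ProbabilityMeasure (ConePoint C))} (hα : ∀ μ ∈ S, StochLE α μ)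
    (hβ : ∀ μ ∈ S, StochLE μ β) :
    IsTightMeasureSet
      {((μ : ProbabilityMeasure (ConePoint C)) : Measure (ConePoint C)) | μ ∈ S} := by
  rw [isTightMeasureSet_iff_exists_isCompact_measure_compl_le]
  intro ε hε
  have hε2 : 0 < ε / 2 := ENNReal.half_pos hε.ne'
  obtain ⟨u⟩ : Nonempty (ConePoint C) :=
    nonempty_of_isProbabilityMeasure (α : Measure (ConePoint C))
  obtain ⟨r, hr, hrα⟩ := ConePoint.exists_measure_compl_above_le hC α u hε2
  obtain ⟨R, hR, hRβ⟩ := ConePoint.exists_measure_compl_below_le hC β u hε2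
  refine ⟨_, ConePoint.isCompact_orderInterval hC (.scale r hr u) (.scale R hR u), ?_⟩
  rintro _ ⟨μ, hμ, rfl⟩
  have hopen := ConePoint.isOpen_setOf_sub_mem hC (r • u.1)
  have hsub : {z : ConePoint C | .scale r hr u ≤ z ∧ z ≤ .scale R hR u}ᶜ ⊆
      {z : ConePoint C | z.1 - r • u.1 ∈ C}ᶜ ∪
        {z : ConePoint C | R • u.1 - z.1 ∈ closure (C : Set E)}ᶜ := by
    rw [← Set.compl_inter]
    exact Set.compl_subset_compl.2 fun z hz => ⟨subset_closure hz.1, hz.2⟩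
  have h1 : (μ : Measure (ConePoint C)) {z | z.1 - r • u.1 ∈ C}ᶜ ≤ ε / 2 := by
    refine le_trans ?_ hrα
    rw [prob_compl_eq_one_sub hopen.measurableSet, prob_compl_eq_one_sub hopen.measurableSet]
    exact tsub_le_tsub_left (hα μ hμ _ hopen (ConePoint.isUpperSet_setOf_sub_mem hC _)) _
  have h2 : (μ : Measure (ConePoint C)) {z | R • u.1 - z.1 ∈ closure (C : Set E)}ᶜ ≤ ε / 2 :=
    (hβ μ hμ _ (ConePoint.isClosed_setOf_sub_mem hC _).isOpen_compl
      (ConePoint.isUpperSet_compl_setOf_sub_mem _)).trans hRβ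
  calc _ ≤ _ := measure_mono hsub
    _ ≤ _ := measure_union_le _ _
    _ ≤ ε / 2 + ε / 2 := add_le_add h1 h2
    _ = ε := ENNReal.add_halves ε

/-- A sequence bounded in the stochastic order whose cluster points are pairwise comparable
converges: Prokhorov's theorem gives a cluster point, and antisymmetry makes it unique. -/
lemma exists_tendsto (hC : IsOpenProperCone C) {μs : ℕ → ProbabilityMeasure (ConePoint C)}
    {α β : ProbabilityMeasure (ConePoint C)} (hα : ∀ n, StochLE α (μs n))
    (hβ : ∀ n, StochLE (μs n) β)
    (h : ∀ μ μ' : ProbabilityMeasure (ConePoint C), MapClusterPt μ atTop μs →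
      MapClusterPt μ' atTop μs → StochLE μ μ') :
    ∃ μ, Tendsto μs atTop (𝓝 μ) := by
  have := ConePoint.metrizableSpace hC
  have hcomp : IsCompact (closure (Set.range μs)) :=
    isCompact_closure_of_isTightMeasureSet (isTightMeasureSet hC
      (by rintro _ ⟨n, rfl⟩; exact hα n) (by rintro _ ⟨n, rfl⟩; exact hβ n))
  have hmem : ∀ n, μs n ∈ closure (Set.range μs) := fun n => subset_closure ⟨n, rfl⟩
  obtain ⟨μ, -, hμ⟩ := hcomp.exists_mapClusterPt (f := atTop) (u := μs)
    (tendsto_principal.2 (.of_forall hmem))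
  exact ⟨μ, hcomp.tendsto_nhds_of_unique_mapClusterPt (.of_forall hmem)
    fun μ' _ hμ' => antisymm hC (h _ _ hμ' hμ) (h _ _ hμ hμ')⟩

variable {μs : ℕ → ProbabilityMeasure (ConePoint C)} {μ ρ : ProbabilityMeasure (ConePoint C)}

lemma of_mapClusterPt_le (hC : IsOpenProperCone C) (hμ : MapClusterPt μ atTop μs)
    (h : ∀ᶠ n in atTop, StochLE (μs n) ρ) : StochLE μ ρ := by
  obtain ⟨F, hF, hlim⟩ := mapClusterPt_iff_ultrafilter.1 hμ
  exact of_tendsto_le hC hlim (hF h)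

lemma of_le_mapClusterPt (hC : IsOpenProperCone C) (hμ : MapClusterPt μ atTop μs)
    (h : ∀ᶠ n in atTop, StochLE ρ (μs n)) : StochLE ρ μ := by
  obtain ⟨F, hF, hlim⟩ := mapClusterPt_iff_ultrafilter.1 hμ
  exact of_le_tendsto hC hlim (hF h)

end StochLE

end Convergence

theorem proposition6p3 {E : Type*} [NormedAddCommGroup E] [NormedSpace ℝ E]
    [FiniteDimensional ℝ E] (C : ConvexCone ℝ E) (hC : IsOpenProperCone C)
    (μs : ℕ → ProbabilityMeasure (ConePoint C)) (ν : ProbabilityMeasure (ConePoint C)) :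
    ((∀ n, StochLE (μs n) (μs (n + 1))) → (∀ n, StochLE (μs n) ν) →
      ∃ μ : ProbabilityMeasure (ConePoint C),
        (∀ n, StochLE (μs n) μ) ∧ StochLE μ ν ∧ Tendsto μs atTop (𝓝 μ)) ∧
    ((∀ n, StochLE (μs (n + 1)) (μs n)) → (∀ n, StochLE ν (μs n)) →
      ∃ μ : ProbabilityMeasure (ConePoint C),
        (∀ n, StochLE μ (μs n)) ∧ StochLE ν μ ∧ Tendsto μs atTop (𝓝 μ)) := by
  -- In both cases a cluster point is on the far side of every `μs m` (because `μs n` is, for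
  -- `n ≥ m`) and on the near side of every bound of the sequence, hence of any other cluster point.
  constructor
  · intro hmono hν
    have hev : ∀ m, ∀ᶠ n in atTop, StochLE (μs m) (μs n) := fun m =>
      (eventually_ge_atTop m).mono fun n hmn => StochLE.of_forall_le_succ hmono hmn
    obtain ⟨μ, hμ⟩ := StochLE.exists_tendsto hC
      (fun n => StochLE.of_forall_le_succ hmono n.zero_le) hν
      fun μ μ' hμ hμ' => StochLE.of_mapClusterPt_le hC hμ
        (.of_forall fun m => StochLE.of_le_mapClusterPt hC hμ' (hev m))
    exact ⟨μ, fun m => StochLE.of_le_tendsto hC hμ (hev m),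
      StochLE.of_tendsto_le hC hμ (.of_forall hν), hμ⟩
  · intro hanti hν
    have hev : ∀ m, ∀ᶠ n in atTop, StochLE (μs n) (μs m) := fun m =>
      (eventually_ge_atTop m).mono fun n hmn => StochLE.of_forall_succ_le hanti hmn
    obtain ⟨μ, hμ⟩ := StochLE.exists_tendsto hC hν
      (fun n => StochLE.of_forall_succ_le hanti n.zero_le)
      fun μ μ' hμ hμ' => StochLE.of_le_mapClusterPt hC hμ'
        (.of_forall fun m => StochLE.of_mapClusterPt_le hC hμ (hev m))
    exact ⟨μ, fun m => StochLE.of_tendsto_le hC hμ (hev m),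
      StochLE.of_le_tendsto hC hμ (.of_forall hν), hμ⟩
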